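/- **Theorem 3.** Setting. A message $b$ of $k$ independent fair bits is encoded by an arbitrary map into a codeword $X\in\{0,1\}^n$, which is sent over $n$ independent uses of the binary symmetric channel with crossover probability $p_{ch}=\mathbb Q\big(\sqrt{\zeta P_T/\sigma_z^2}\big)$, where $\mathbb Q(x)=\int_x^\infty \frac1{\sqrt{2\pi}}e^{-t^2/2}\,dt$ and $\zeta,\sigma_z^2,P_T>0$ are the path loss, the noise variance and the transmit power (this is BPSK over an AWGN channel with hard decisions). The decoder is a circuit: a set of nodes lying on the lattice $(\lambda\mathbb Z)^2$, $\lambda>0$, inside a square $[0,l]^2$, among them $n$ distinct input nodes, each storing one bit of the channel output $Y$, and $k$ distinct output nodes, each holding one bit of the estimate $\widehat b$ at the end. It performs a fixed-message-length computation: finitely many messages are sent between pairs of distinct nodes, with order, endpoints and lengths in bits fixed in advance; each message is a function of the input bit of the transmitting node (if it has one) and of the messages which that node has received before, and each output bit is a function of the input bit (if any) of its node and of all messages which that node has received. The bit-meters of the computation are the sum over all messages of the number of bits times the Euclidean distance between the two nodes. The block-error probability is $P_e^{\mathrm{blk}}=\Pr(\widehat b\ne b)$. Claim. For every rate $R>0$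 and every $\delta>0$ there is an $N$, depending only on $R$ and $\delta$, such that for all $n\ge N$, all $k\ge Rn$, all $\zeta,\sigma_z^2,P_T>0$ with $$\log n>100\log\frac1{2p_{ch}},$$ all $\lambda>0$, all encoders and all decoders as above with $P_e^{\mathrm{blk}}\le 1-\delta$, $$\text{bit-meters}\ \ge\ \frac{k}{192}\sqrt{\frac{\log n}{\log\frac1{2p_{ch}}}}\;\lambda .$$ In particular, at fixed transmit power, the bit-meters per information bit grow at least like $\sqrt{\log n}$. -/

import Mathlib

noncomputable section

namespace InfoFriction

/-- The tail of the standard Gaussian law, `Q(x) = ∫_x^∞ (2π)^(-1/2) exp(-t²/2) dt`. -/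
def gaussianTail (x : ℝ) : ℝ :=
  ∫ t in Set.Ioi x, 1 / Real.sqrt (2 * Real.pi) * Real.exp (-t ^ 2 / 2)

/-- Channel Model `(ζ, σ²)` at transmit power `P`: BPSK over an AWGN channel with path loss `ζ`,
noise variance `σ²` and a hard decision at the receiver is a binary symmetric channel with this
crossover probability. -/
def crossover (zeta sigmaSq P : ℝ) : ℝ :=
  gaussianTail (Real.sqrt (zeta * P / sigmaSq))

/-- Probability that `n` independent uses of the binary symmetric channel with crossover
probability `p` turn the channel input `x` into the channel output `y`. -/
def bscProb {n : ℕ} (p : ℝ) (x y : Fin n → Bool) : ℝ :=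
  ∏ j, if y j = x j then 1 - p else p

/-- Average block-error probability `Pr (b̂ ≠ b)`: `b` consists of `k` independent fair bits, it is
encoded by `enc`, sent over the binary symmetric channel, and estimated by `dec`. -/
def blockErrorProb {n k : ℕ} (p : ℝ) (enc : (Fin k → Bool) → (Fin n → Bool))
    (dec : (Fin n → Bool) → (Fin k → Bool)) : ℝ :=
  ∑ b : Fin k → Bool, (1 / 2 : ℝ) ^ k *
    ∑ y : Fin n → Bool, bscProb p (enc b) y * (if dec y = b then 0 else 1)

/-- The parameters of the implementation model: the lattice spacing `λ` (the minimum distance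
between computational nodes) and the coefficient of information friction `μ` (the energy spent
per bit-meter, which plays no role for the number of bit-meters itself). -/
structure ImplementationModel where
  spacing : ℝ
  friction : ℝ
  spacing_pos : 0 < spacing
  friction_nonneg : 0 ≤ friction

/-- The square `[0, l] × [0, l]`. -/
def substrate (l : ℝ) : Set (EuclideanSpace ℝ (Fin 2)) :=
  {x | ∀ i, 0 ≤ x i ∧ x i ≤ l}

/-- The points `(s λ, t λ)` with integers `s`, `t`. -/
def squareLattice (spacing : ℝ) : Set (EuclideanSpace ℝ (Fin 2)) :=
  {x | ∀ i, ∃ s : ℤ, x i = s * spacing}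

/-- A circuit: a square substrate with a collection of computational nodes that are points of the
square lattice lying in the substrate. -/
structure Circuit (M : ImplementationModel) where
  side : ℝ
  nodes : Set (EuclideanSpace ℝ (Fin 2))
  nodes_subset : nodes ⊆ squareLattice M.spacing ∩ substrate side

/-- A fixed-message-length computation with `n` input bits and `k` output bits on a circuit.

There are `n` distinct input nodes, which store one input bit each, and `k` distinct output nodes,
which hold one output bit each at the end (an input node may also serve as an output node; all
other nodes are helper nodes). The computation consists of `steps` messages, in a predetermined
order; the `t`-th message goes over the link from node `src t` to node `dst t` and has the
predetermined length of `size t` bits. `message y t` is the content of the `t`-th message when the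
input of the computation is `y`; it is a function of what its transmitting node knows at that
time, namely its own input bit (if it has one) and the messages it has received so far. The output
bit is, in the same way, a function of what its output node knows at the end. -/
structure FixedLengthComputation {M : ImplementationModel} (C : Circuit M) (n k : ℕ) where
  inputNode : Fin n → C.nodes
  inputNode_injective : Function.Injective inputNode
  outputNode : Fin k → C.nodes
  outputNode_injective : Function.Injective outputNode
  steps : ℕ
  src : Fin steps → C.nodes
  dst : Fin steps → C.nodes
  src_ne_dst : ∀ t, src t ≠ dst t
  size : Fin steps → ℕ
  message : (Fin n → Bool) → (t : Fin steps) → Fin (size t) → Bool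
  message_local : ∀ (t : Fin steps) (y y' : Fin n → Bool),
    (∀ j, inputNode j = src t → y j = y' j) →
    (∀ s, s < t → dst s = src t → message y s = message y' s) →
    message y t = message y' t
  output : (Fin n → Bool) → Fin k → Bool
  output_local : ∀ (i : Fin k) (y y' : Fin n → Bool),
    (∀ j, inputNode j = outputNode i → y j = y' j) →
    (∀ s, dst s = outputNode i → message y s = message y' s) →
    output y i = output y' i

/-- The bit-meters of a computation: number of bits times Euclidean distance, summed over all the
messages on all the links. -/
def FixedLengthComputation.bitMeters {M : ImplementationModel} {C : Circuit M} {n k : ℕ}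
    (D : FixedLengthComputation C n k) : ℝ :=
  ∑ t, (D.size t : ℝ) *
    dist (D.src t : EuclideanSpace ℝ (Fin 2)) (D.dst t : EuclideanSpace ℝ (Fin 2))

end InfoFriction

end

/-!
Put `L = log (1 / (2 * p))`. The binary symmetric channel with crossover probability `p` erases each
bit independently with probability `2 * p = exp (-L)` and replaces the erased bits by fair bits.
Call `T` the set of erased coordinates. If fixing the bits in `T` leaves the decoder at most `m`
possible estimates, then it is right with probability at most `m / 2 ^ k`.

Cut the circuit into blocks of `a × a` lattice points, which hold at most `a ^ 2` input nodes each.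
A block that outputs more bits than it receives must guess at least one bit when all its inputs are
erased, so each such block multiplies the success probability by at most `1 - (2 * p) ^ a ^ 2 / 2`,
and the blocks are independent. Averaging over the `a` diagonal shifts of the grid, some shift has
at most `2 * bitMeters / (a * λ)` bits crossing between blocks. If this is at most `k / 2`, at least
`k / (2 * a ^ 2)` blocks are short of bits, and the success probability is at most
`exp (-k * (2 * p) ^ a ^ 2 / (4 * a ^ 2))`. With `a = ⌊√(log n / (c * L))⌋` and `c > 1` the exponent
is of order at least `n ^ (1 - 1 / c) / log n` as long as `L` is bounded below; for
`L ≤ R * log 2 / 2` the rate exceeds capacity and decoding fails for every computation.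
-/

namespace InfoFriction

open Finset MeasureTheory ProbabilityTheory

theorem gaussianTail_eq_setIntegral_gaussianPDFReal (x : ℝ) :
    gaussianTail x = ∫ t in Set.Ioi x, gaussianPDFReal 0 1 t := by
  simp [gaussianTail, gaussianPDFReal]

theorem gaussianTail_strictAnti : StrictAnti gaussianTail := by
  intro x y hxy
  have hint := integrable_gaussianPDFReal 0 1
  have hpos : 0 < ∫ t in x..y, gaussianPDFReal 0 1 t :=
    intervalIntegral.intervalIntegral_pos_of_pos hint.intervalIntegrable
      (fun t => gaussianPDFReal_pos 0 1 t one_ne_zero) hxy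
  rw [← intervalIntegral.integral_Ioi_sub_Ioi hint.integrableOn hxy.le] at hpos
  simpa only [gaussianTail_eq_setIntegral_gaussianPDFReal, sub_pos] using hpos

theorem gaussianTail_nonneg (x : ℝ) : 0 ≤ gaussianTail x := by
  rw [gaussianTail_eq_setIntegral_gaussianPDFReal]
  exact integral_nonneg fun t => gaussianPDFReal_nonneg 0 1 t

theorem gaussianTail_zero : gaussianTail 0 = 1 / 2 := by
  have hexponent (t : ℝ) : -t ^ 2 / 2 = -(1 / 2) * t ^ 2 := by ring
  have hvariance : Real.pi / (1 / 2) = 2 * Real.pi := by ring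
  simp only [gaussianTail, hexponent]
  rw [integral_const_mul, integral_gaussian_Ioi, hvariance]
  field_simp

theorem crossover_pos (zeta sigmaSq P : ℝ) : 0 < crossover zeta sigmaSq P :=
  (gaussianTail_nonneg _).trans_lt (gaussianTail_strictAnti (lt_add_one _))

theorem crossover_lt_half {zeta sigmaSq P : ℝ} (hzeta : 0 < zeta) (hsigmaSq : 0 < sigmaSq)
    (hP : 0 < P) : crossover zeta sigmaSq P < 1 / 2 := by
  rw [← gaussianTail_zero]
  exact gaussianTail_strictAnti (Real.sqrt_pos.2 (by positivity))

section Channel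

variable {n k : ℕ}

theorem sum_bscProb (p : ℝ) (x : Fin n → Bool) : ∑ y, bscProb p x y = 1 := by
  simp only [bscProb]
  rw [← Fintype.prod_sum fun j (a : Bool) => if a = x j then 1 - p else p]
  exact prod_eq_one fun j _ => by cases x j <;> simp

theorem bscProb_le {p : ℝ} (hp₀ : 0 ≤ p) (hp : p ≤ 1 / 2) (x y : Fin n → Bool) :
    bscProb p x y ≤ (1 - p) ^ n := by
  rw [← Fin.prod_const]
  exact prod_le_prod (fun j _ => by split_ifs <;> linarith) fun j _ => by split_ifs <;> linarith

/-- The probability `Pr (b̂ = b)` of correct decoding: the channel output `y` is decoded correctly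
if and only if the message was `dec y`, so a single sum over `y` suffices. -/
noncomputable def successProb (p : ℝ) (enc : (Fin k → Bool) → (Fin n → Bool))
    (dec : (Fin n → Bool) → (Fin k → Bool)) : ℝ :=
  (1 / 2 : ℝ) ^ k * ∑ y, bscProb p (enc (dec y)) y

theorem blockErrorProb_eq_one_sub_successProb (p : ℝ) (enc : (Fin k → Bool) → (Fin n → Bool))
    (dec : (Fin n → Bool) → (Fin k → Bool)) :
    blockErrorProb p enc dec = 1 - successProb p enc dec := by
  have herror (b : Fin k → Bool) :
      ∑ y, bscProb p (enc b) y * (if dec y = b then (0 : ℝ) else 1) =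
        1 - ∑ y, if dec y = b then bscProb p (enc b) y else 0 := by
    rw [eq_sub_iff_add_eq, ← sum_add_distrib]
    exact (sum_congr rfl fun y _ => by split_ifs <;> simp).trans (sum_bscProb p (enc b))
  have hsuccess : ∑ b, ∑ y, (if dec y = b then bscProb p (enc b) y else 0) =
      ∑ y, bscProb p (enc (dec y)) y := by
    rw [sum_comm]
    simp only [sum_ite_eq, mem_univ, if_true]
  simp only [blockErrorProb, successProb, herror]
  rw [← mul_sum, sum_sub_distrib, hsuccess, mul_sub]
  simp

theorem successProb_le_exp {p : ℝ} (hp₀ : 0 < p) (hp : p ≤ 1 / 2)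
    (enc : (Fin k → Bool) → (Fin n → Bool)) (dec : (Fin n → Bool) → (Fin k → Bool)) :
    successProb p enc dec ≤ Real.exp (n * Real.log (1 / (2 * p)) - k * Real.log 2) := by
  have hbase : 2 * (1 - p) ≤ 1 / (2 * p) := by
    rw [le_div_iff₀ (by positivity)]
    nlinarith [sq_nonneg (2 * p - 1)]
  calc successProb p enc dec
      ≤ (1 / 2 : ℝ) ^ k * ∑ _y : Fin n → Bool, (1 - p) ^ n := by
        unfold successProb
        gcongr
        exact bscProb_le hp₀.le hp _ _
    _ = (2 * (1 - p)) ^ n / 2 ^ k := by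
        simp only [sum_const, card_univ, Fintype.card_fun, Fintype.card_bool, Fintype.card_fin,
          nsmul_eq_mul, Nat.cast_pow, Nat.cast_ofNat, mul_pow, one_div, inv_pow]
        ring
    _ ≤ (1 / (2 * p)) ^ n / 2 ^ k := by
        gcongr
        linarith
    _ = Real.exp (n * Real.log (1 / (2 * p)) - k * Real.log 2) := by
        rw [Real.exp_sub, Real.exp_nat_mul, Real.exp_nat_mul, Real.exp_log (by positivity),
          Real.exp_log two_pos]

end Channel

section Erasures

variable {ι : Type*} [Fintype ι] [DecidableEq ι]

/-- The probability that `T` is the set of erased coordinates when every coordinate is erased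
independently with probability `q`. -/
noncomputable def erasureProb (q : ℝ) (T : Finset ι) : ℝ := q ^ #T * (1 - q) ^ #Tᶜ

theorem erasureProb_nonneg {q : ℝ} (hq₀ : 0 ≤ q) (hq₁ : q ≤ 1) (T : Finset ι) :
    0 ≤ erasureProb q T :=
  mul_nonneg (pow_nonneg hq₀ _) (pow_nonneg (sub_nonneg.2 hq₁) _)

theorem sum_erasureProb_superset (q : ℝ) (F : Finset ι) :
    ∑ T with F ⊆ T, erasureProb q T = q ^ #F := by
  have hcompl (T : Finset ι) : (∀ j ∈ Tᶜ, j ∉ F) ↔ F ⊆ T := by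
    simp only [mem_compl, not_imp_not, subset_iff]
  calc ∑ T with F ⊆ T, erasureProb q T
      = ∑ T, (∏ _j ∈ T, q) * ∏ j ∈ Tᶜ, if j ∉ F then 1 - q else 0 := by
        simp only [prod_ite_zero, hcompl, prod_const, mul_ite, mul_zero, sum_filter, erasureProb]
    _ = ∏ j, (q + if j ∉ F then 1 - q else 0) := (Fintype.prod_add _ _).symm
    _ = ∏ j, if j ∈ F then q else 1 := prod_congr rfl fun j _ => by split_ifs <;> simp
    _ = q ^ #F := by simp

theorem sum_erasureProb_mul_pow_card {κ : Type*} (q t : ℝ) {G : Finset κ}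
    {F : κ → Finset ι} (hF : (G : Set κ).PairwiseDisjoint F) :
    ∑ T, erasureProb q T * t ^ #{c ∈ G | F c ⊆ T} = ∏ c ∈ G, (1 - (1 - t) * q ^ #(F c)) := by
  classical
  have hexpand (T : Finset ι) : t ^ #{c ∈ G | F c ⊆ T} =
      ∑ H ∈ G.powerset, if H.biUnion F ⊆ T then (t - 1) ^ #H else 0 := by
    calc t ^ #{c ∈ G | F c ⊆ T} = ∏ c ∈ G, (1 + if F c ⊆ T then t - 1 else 0) := by
          rw [← prod_const, prod_filter]
          exact prod_congr rfl fun c _ => by split_ifs <;> ring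
      _ = _ := by simp only [prod_one_add, prod_ite_zero, prod_const, biUnion_subset]
  calc ∑ T, erasureProb q T * t ^ #{c ∈ G | F c ⊆ T}
      = ∑ H ∈ G.powerset, (t - 1) ^ #H * ∑ T with H.biUnion F ⊆ T, erasureProb q T := by
        simp only [hexpand, mul_sum, sum_filter]
        rw [sum_comm]
        exact sum_congr rfl fun H _ => sum_congr rfl fun T _ => by split_ifs <;> ring
    _ = ∑ H ∈ G.powerset, ∏ c ∈ H, (t - 1) * q ^ #(F c) := by
        refine sum_congr rfl fun H hH => ?_
        rw [sum_erasureProb_superset, card_biUnion (hF.subset (coe_subset.2 (mem_powerset.1 hH))),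
          prod_mul_distrib, prod_const, prod_pow_eq_pow_sum]
    _ = ∏ c ∈ G, (1 - (1 - t) * q ^ #(F c)) := by
        rw [← prod_one_add]
        exact prod_congr rfl fun c _ => by ring

variable {α β : Type*} [Fintype α] [DecidableEq α] [DecidableEq β]

/-- The values that the decoder `g` can still take once the coordinates in `T` of its argument are
known to be those of `y₀`. -/
def residualRange (g : (ι → α) → β) (T : Finset ι) (y₀ : ι → α) : Finset β :=
  image g {y | ∀ j ∈ T, y j = y₀ j}

theorem card_residualRange_le_card {γ : Type*} [Fintype γ] {g : (ι → α) → β} {T : Finset ι}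
    {h : (ι → α) → γ} (hgh : ∀ y y', (∀ j ∈ T, y j = y' j) → h y = h y' → g y = g y')
    (y₀ : ι → α) : #(residualRange g T y₀) ≤ Fintype.card γ := by
  have hpreimage (b : residualRange g T y₀) : ∃ y, (∀ j ∈ T, y j = y₀ j) ∧ g y = b := by
    simpa [residualRange] using b.2
  choose w hwT hgw using hpreimage
  rw [← Fintype.card_coe]
  refine Fintype.card_le_of_injective (h ∘ w) fun b b' heq => Subtype.ext ?_
  rw [← hgw b, ← hgw b', hgh _ _ (fun j hj => (hwT b j hj).trans (hwT b' j hj).symm) heq]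

theorem card_eq_encode_off_le (enc : β → ι → α) (dec : (ι → α) → β) (T : Finset ι) {m : ℕ}
    (hm : ∀ y₀, #(residualRange dec T y₀) ≤ m) :
    #{y | ∀ j ∈ Tᶜ, y j = enc (dec y) j} ≤ m * Fintype.card α ^ #T := by
  set S : Finset (ι → α) := {y | ∀ j ∈ Tᶜ, y j = enc (dec y) j} with hS
  -- Off `T` a point of `S` is determined by its decoded value, so `dec` is injective on fibers.
  have hfiber : ∀ a ∈ S.image T.restrict, #{y ∈ S | T.restrict y = a} ≤ m := by
    intro a ha
    obtain ⟨y₀, -, rfl⟩ := mem_image.1 ha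
    refine (card_le_card_of_injOn dec (fun y hy => ?_) (fun y hy y' hy' hdec => ?_)).trans (hm y₀)
    · have hagree : T.restrict y = T.restrict y₀ := (mem_filter.1 hy).2
      exact mem_image_of_mem dec
        (mem_filter.2 ⟨mem_univ y, fun j hj => congrFun hagree ⟨j, hj⟩⟩)
    · simp only [hS, coe_filter, mem_filter, mem_univ, true_and, Set.mem_ofPred_eq] at hy hy'
      funext j
      by_cases hj : j ∈ T
      · exact congrFun (hy.2.trans hy'.2.symm) ⟨j, hj⟩
      · rw [hy.1 j (mem_compl.2 hj), hy'.1 j (mem_compl.2 hj), hdec]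
  calc #S ≤ m * #(S.image T.restrict) := card_le_mul_card_image S m hfiber
    _ ≤ m * Fintype.card (T → α) := by gcongr; exact card_le_univ _
    _ = m * Fintype.card α ^ #T := by rw [Fintype.card_fun, Fintype.card_coe]

end Erasures

section Channel

variable {n k : ℕ}

-- As `p ^ #T = (2 * p) ^ #T * (1 / 2) ^ #T`, this says that the bits in a random set `T` are erased
-- and replaced by fair bits.
theorem bscProb_eq_sum_erasures (p : ℝ) (x y : Fin n → Bool) :
    bscProb p x y =
      ∑ T : Finset (Fin n), if ∀ j ∈ Tᶜ, y j = x j then p ^ #T * (1 - 2 * p) ^ #Tᶜ else 0 := by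
  calc bscProb p x y = ∏ j, (p + if y j = x j then 1 - 2 * p else 0) :=
        prod_congr rfl fun j _ => by split_ifs <;> ring
    _ = _ := by
        simp only [Fintype.prod_add, prod_ite_zero, prod_const, mul_ite, mul_zero]

theorem successProb_le_sum_erasureProb {p : ℝ} (hp₀ : 0 ≤ p) (hp : p ≤ 1 / 2)
    (enc : (Fin k → Bool) → (Fin n → Bool)) (dec : (Fin n → Bool) → (Fin k → Bool))
    {m : Finset (Fin n) → ℕ} (hm : ∀ T y₀, #(residualRange dec T y₀) ≤ m T) :
    successProb p enc dec ≤ ∑ T, erasureProb (2 * p) T * (m T / 2 ^ k) := by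
  have hcard (T : Finset (Fin n)) :
      (#{y | ∀ j ∈ Tᶜ, y j = enc (dec y) j} : ℝ) ≤ m T * 2 ^ #T := by
    have h := card_eq_encode_off_le enc dec T (hm T)
    rw [Fintype.card_bool] at h
    convert (mod_cast h : ((_ : ℕ) : ℝ) ≤ m T * 2 ^ #T)
  calc successProb p enc dec
      = ∑ T : Finset (Fin n), (1 / 2 : ℝ) ^ k *
          (#{y | ∀ j ∈ Tᶜ, y j = enc (dec y) j} * (p ^ #T * (1 - 2 * p) ^ #Tᶜ)) := by
        simp only [successProb, bscProb_eq_sum_erasures]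
        rw [sum_comm, mul_sum]
        simp only [← sum_filter, sum_const, nsmul_eq_mul]
    _ ≤ ∑ T : Finset (Fin n), (1 / 2 : ℝ) ^ k *
          (m T * 2 ^ #T * (p ^ #T * (1 - 2 * p) ^ #Tᶜ)) := by
        have : 0 ≤ 1 - 2 * p := by linarith
        gcongr with T
        exact hcard T
    _ = ∑ T, erasureProb (2 * p) T * (m T / 2 ^ k) := by
        refine sum_congr rfl fun T _ => ?_
        rw [erasureProb, mul_pow, one_div, inv_pow]
        ring

end Channel

namespace FixedLengthComputation

variable {M : ImplementationModel} {C : Circuit M} {n k : ℕ} (D : FixedLengthComputation C n k)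

section Locality

variable {D} {κ : Type*} {f : C.nodes → κ} {E : Set κ} {y y' : Fin n → Bool}

theorem message_eq_of_incoming_eq (hy : ∀ j, f (D.inputNode j) ∈ E → y j = y' j)
    (hm : ∀ t, f (D.dst t) ∈ E → f (D.src t) ≠ f (D.dst t) → D.message y t = D.message y' t)
    (t : Fin D.steps) (ht : f (D.dst t) ∈ E) : D.message y t = D.message y' t := by
  induction t using WellFoundedLT.induction with
  | ind t ih =>
    by_cases hcell : f (D.src t) = f (D.dst t)
    · rw [← hcell] at ht
      exact D.message_local t y y' (fun j hj => hy j (by rwa [hj]))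
        fun s hst hs => ih s hst (by rwa [hs])
    · exact hm t ht hcell

theorem output_eq_of_incoming_eq (hy : ∀ j, f (D.inputNode j) ∈ E → y j = y' j)
    (hm : ∀ t, f (D.dst t) ∈ E → f (D.src t) ≠ f (D.dst t) → D.message y t = D.message y' t)
    (i : Fin k) (hi : f (D.outputNode i) ∈ E) : D.output y i = D.output y' i :=
  D.output_local i y y' (fun j hj => hy j (by rwa [hj]))
    fun s hs => message_eq_of_incoming_eq hy hm s (by rwa [hs])

end Locality

section Cells

variable {κ : Type*} [DecidableEq κ] (f : C.nodes → κ)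

/-- The input bits stored in cell `c` of the partition of the circuit into the fibers of `f`. -/
def inputsIn (c : κ) : Finset (Fin n) := {j | f (D.inputNode j) = c}

/-- The output bits held in cell `c` of the partition into the fibers of `f`. -/
def outputsIn (c : κ) : Finset (Fin k) := {i | f (D.outputNode i) = c}

/-- The number of bits that enter cell `c` from other cells. -/
def incomingBits (c : κ) : ℕ :=
  ∑ t with f (D.dst t) = c ∧ f (D.src t) ≠ f (D.dst t), D.size t

/-- The number of bits exchanged between different cells. -/
def crossingBits : ℕ := ∑ t with f (D.src t) ≠ f (D.dst t), D.size t

/-- The cells that output more bits than they receive from other cells: once all the input bits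
stored in such a cell are erased, its output has to be guessed. -/
def starvedCells : Finset κ :=
  {c ∈ univ.image (f ∘ D.outputNode) | D.incomingBits f c < #(D.outputsIn f c)}

theorem pairwiseDisjoint_inputsIn (E : Set κ) : E.PairwiseDisjoint (D.inputsIn f) :=
  fun _ _ _ _ hne => disjoint_filter.2 fun _ _ h h' => hne (h.symm.trans h')

theorem sum_incomingBits (E : Finset κ) :
    ∑ c ∈ E, D.incomingBits f c =
      ∑ t with f (D.dst t) ∈ E ∧ f (D.src t) ≠ f (D.dst t), D.size t := by
  simp only [incomingBits, sum_filter, ite_and]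
  rw [sum_comm]
  exact sum_congr rfl fun t _ => sum_ite_eq E (f (D.dst t)) _

theorem sum_card_outputsIn (E : Finset κ) :
    ∑ c ∈ E, #(D.outputsIn f c) = #{i | f (D.outputNode i) ∈ E} := by
  simp only [outputsIn, card_filter]
  rw [sum_comm]
  exact sum_congr rfl fun i _ => sum_ite_eq E (f (D.outputNode i)) _

theorem sum_incomingBits_le_crossingBits (E : Finset κ) :
    ∑ c ∈ E, D.incomingBits f c ≤ D.crossingBits f := by
  rw [sum_incomingBits]
  exact sum_le_sum_of_subset (monotone_filter_right _ fun _ _ h => h.2)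

theorem card_residualRange_output_le {E : Finset κ} {T : Finset (Fin n)}
    (hT : ∀ c ∈ E, D.inputsIn f c ⊆ T) (y₀ : Fin n → Bool) :
    #(residualRange D.output T y₀) ≤
      2 ^ (∑ c ∈ E, D.incomingBits f c) * 2 ^ #{i | f (D.outputNode i) ∉ E} := by
  let I : Finset (Fin D.steps) := {t | f (D.dst t) ∈ E ∧ f (D.src t) ≠ f (D.dst t)}
  let J : Finset (Fin k) := {i | f (D.outputNode i) ∉ E}
  let transcript (y : Fin n → Bool) : (∀ t : I, Fin (D.size t) → Bool) × (J → Bool) :=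
    (fun t => D.message y t, fun i => D.output y i)
  have hcard : Fintype.card ((∀ t : I, Fin (D.size t) → Bool) × (J → Bool)) =
      2 ^ (∑ c ∈ E, D.incomingBits f c) * 2 ^ #J := by
    rw [sum_incomingBits, ← prod_pow_eq_pow_sum, ← prod_coe_sort]
    simp [I]
  refine (card_residualRange_le_card (h := transcript) (fun y y' hy heq => ?_) y₀).trans_eq hcard
  simp only [transcript, Prod.mk.injEq, funext_iff] at heq
  funext i
  by_cases hi : f (D.outputNode i) ∈ E
  · refine output_eq_of_incoming_eq (f := f) (E := E) (fun j hj => ?_) (fun t ht hne => ?_) i hi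
    · exact hy j (hT _ hj (mem_filter.2 ⟨mem_univ j, rfl⟩))
    · exact funext (heq.1 ⟨t, mem_filter.2 ⟨mem_univ t, ht, hne⟩⟩)
  · exact heq.2 ⟨i, mem_filter.2 ⟨mem_univ i, hi⟩⟩

theorem card_residualRange_output_mul_two_pow_le {E : Finset κ} {T : Finset (Fin n)}
    (hE : E ⊆ D.starvedCells f) (hT : ∀ c ∈ E, D.inputsIn f c ⊆ T) (y₀ : Fin n → Bool) :
    #(residualRange D.output T y₀) * 2 ^ #E ≤ 2 ^ k := by
  have hstarved : ∑ c ∈ E, D.incomingBits f c + #E ≤ #{i | f (D.outputNode i) ∈ E} := by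
    rw [← D.sum_card_outputsIn f, card_eq_sum_ones, ← sum_add_distrib]
    exact sum_le_sum fun c hc => (mem_filter.1 (hE hc)).2
  have hk : #{i | f (D.outputNode i) ∈ E} + #{i | f (D.outputNode i) ∉ E} = k := by
    rw [card_filter_add_card_filter_not, card_univ, Fintype.card_fin]
  calc #(residualRange D.output T y₀) * 2 ^ #E
      ≤ 2 ^ (∑ c ∈ E, D.incomingBits f c) * 2 ^ #{i | f (D.outputNode i) ∉ E} * 2 ^ #E := by
        gcongr
        exact D.card_residualRange_output_le f hT y₀
    _ ≤ 2 ^ k := by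
        rw [← pow_add, ← pow_add]
        exact Nat.pow_le_pow_right two_pos (by lia)

theorem successProb_le_prod_starvedCells {p : ℝ} (hp₀ : 0 ≤ p) (hp : p ≤ 1 / 2)
    (enc : (Fin k → Bool) → (Fin n → Bool)) :
    successProb p enc D.output ≤
      ∏ c ∈ D.starvedCells f, (1 - 1 / 2 * (2 * p) ^ #(D.inputsIn f c)) := by
  let erased (T : Finset (Fin n)) : Finset κ := {c ∈ D.starvedCells f | D.inputsIn f c ⊆ T}
  have hrange (T : Finset (Fin n)) (y₀ : Fin n → Bool) :
      #(residualRange D.output T y₀) ≤ 2 ^ k / 2 ^ #(erased T) :=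
    (Nat.le_div_iff_mul_le (by positivity)).2 <|
      D.card_residualRange_output_mul_two_pow_le f (filter_subset _ _)
        (fun _ hc => (mem_filter.1 hc).2) y₀
  calc successProb p enc D.output
      ≤ ∑ T, erasureProb (2 * p) T * ((2 ^ k / 2 ^ #(erased T) : ℕ) / 2 ^ k) :=
        successProb_le_sum_erasureProb hp₀ hp enc D.output hrange
    _ ≤ ∑ T, erasureProb (2 * p) T * (1 / 2) ^ #(erased T) := by
        refine sum_le_sum fun T _ => mul_le_mul_of_nonneg_left ?_
          (erasureProb_nonneg (by linarith) (by linarith) T)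
        rw [div_le_iff₀ (by positivity)]
        refine Nat.cast_div_le.trans_eq ?_
        push_cast
        rw [one_div, inv_pow]
        ring
    _ = ∏ c ∈ D.starvedCells f, (1 - (1 - 1 / 2) * (2 * p) ^ #(D.inputsIn f c)) :=
        sum_erasureProb_mul_pow_card _ _ (D.pairwiseDisjoint_inputsIn f _)
    _ = _ := by norm_num

theorem le_crossingBits_add_mul_card_starvedCells {A : ℕ}
    (hout : ∀ c, #(D.outputsIn f c) ≤ A) :
    k ≤ D.crossingBits f + A * #(D.starvedCells f) := by
  set S : Finset κ := univ.image (f ∘ D.outputNode) with hS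
  calc k = ∑ c ∈ S, #(D.outputsIn f c) := by
        rw [sum_card_outputsIn, filter_true_of_mem fun i _ => by simp [hS], card_univ,
          Fintype.card_fin]
    _ ≤ ∑ c ∈ S, (D.incomingBits f c + if D.incomingBits f c < #(D.outputsIn f c) then A else 0) :=
        sum_le_sum fun c _ => by split_ifs <;> grind
    _ = ∑ c ∈ S, D.incomingBits f c + A * #(D.starvedCells f) := by
        rw [sum_add_distrib, ← sum_filter, sum_const, smul_eq_mul, mul_comm]
        rfl
    _ ≤ D.crossingBits f + A * #(D.starvedCells f) := by
        gcongr
        exact D.sum_incomingBits_le_crossingBits f S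

theorem successProb_le_exp_of_crossingBits_le {p : ℝ} (hp₀ : 0 ≤ p) (hp : p ≤ 1 / 2)
    (enc : (Fin k → Bool) → (Fin n → Bool)) {A : ℕ} (hin : ∀ c, #(D.inputsIn f c) ≤ A)
    (hout : ∀ c, #(D.outputsIn f c) ≤ A) (hcross : (D.crossingBits f : ℝ) ≤ k / 2) :
    successProb p enc D.output ≤ Real.exp (-(k * (2 * p) ^ A / (4 * A))) := by
  have hstarved : (k : ℝ) / (2 * A) ≤ #(D.starvedCells f) := by
    have hk : (k : ℝ) ≤ D.crossingBits f + A * #(D.starvedCells f) :=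
      mod_cast D.le_crossingBits_add_mul_card_starvedCells f hout
    exact div_le_of_le_mul₀ (by positivity) (by positivity) (by linarith)
  calc successProb p enc D.output
      ≤ ∏ c ∈ D.starvedCells f, (1 - 1 / 2 * (2 * p) ^ #(D.inputsIn f c)) :=
        D.successProb_le_prod_starvedCells f hp₀ hp enc
    _ ≤ ∏ _c ∈ D.starvedCells f, Real.exp (-((2 * p) ^ A / 2)) := by
        refine prod_le_prod (fun c _ => ?_) fun c _ => ?_
        · linarith [pow_le_one₀ (n := #(D.inputsIn f c)) (by positivity : 0 ≤ 2 * p) (by linarith)]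
        · have hpow : (2 * p) ^ A ≤ (2 * p) ^ #(D.inputsIn f c) :=
            pow_le_pow_of_le_one (by positivity) (by linarith) (hin c)
          linarith [Real.one_sub_le_exp_neg ((2 * p) ^ A / 2)]
    _ = Real.exp (-(#(D.starvedCells f) * ((2 * p) ^ A / 2))) := by
        rw [prod_const, ← Real.exp_nat_mul, mul_neg]
    _ ≤ Real.exp (-(k / (2 * A) * ((2 * p) ^ A / 2))) := by gcongr
    _ = Real.exp (-(k * (2 * p) ^ A / (4 * A))) := by ring_nf

end Cells

end FixedLengthComputation

theorem card_ediv_ne_le {a : ℕ} (ha : 0 < a) (x y : ℤ) :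
    #{u ∈ range a | (x + (u : ℕ)) / (a : ℤ) ≠ (y + u) / a} ≤ (x - y).natAbs := by
  wlog hxy : x ≤ y generalizing x y
  · rw [← Int.natAbs_neg, neg_sub]
    simpa only [ne_comm] using this y x (le_of_not_ge hxy)
  have ha' : (0 : ℤ) < a := mod_cast ha
  -- A shift that separates `x` from `y` moves a multiple of `a` into their gap, so it is the
  -- residue of `-m` for some `m` in `(x, y]`.
  have hsubset : {u ∈ range a | (x + (u : ℕ)) / (a : ℤ) ≠ (y + u) / a} ⊆
      (Ioc x y).image fun m => (-m % a).toNat := by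
    intro u hu
    obtain ⟨hua, hne⟩ := mem_filter.1 hu
    have hlt : (x + u) / (a : ℤ) < (y + u) / a :=
      lt_of_le_of_ne (Int.ediv_le_ediv ha' (by linarith)) hne
    refine mem_image.2 ⟨(y + u) / a * a - u, mem_Ioc.2 ⟨?_, ?_⟩, ?_⟩
    · linarith [(Int.ediv_lt_iff_lt_mul ha').1 hlt]
    · linarith [Int.ediv_mul_le (y + u) ha'.ne']
    · rw [neg_sub, Int.sub_mul_emod_self_right,
        Int.emod_eq_of_lt (by positivity) (mod_cast mem_range.1 hua), Int.toNat_natCast]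
  calc _ ≤ #((Ioc x y).image fun m => (-m % a).toNat) := card_le_card hsubset
    _ ≤ #(Ioc x y) := card_image_le
    _ = (x - y).natAbs := by rw [Int.card_Ioc]; lia

namespace Circuit

variable {M : ImplementationModel} (C : Circuit M)

/-- The integers `s i` such that the coordinates of the node are `s i * λ`; nodes being lattice
points, the floor discards nothing. -/
noncomputable def latticeCoord (v : C.nodes) (i : Fin 2) : ℤ :=
  ⌊(v : EuclideanSpace ℝ (Fin 2)) i / M.spacing⌋

theorem latticeCoord_mul_spacing (v : C.nodes) (i : Fin 2) :
    C.latticeCoord v i * M.spacing = (v : EuclideanSpace ℝ (Fin 2)) i := by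
  obtain ⟨s, hs⟩ := (C.nodes_subset v.2).1 i
  rw [latticeCoord, hs, mul_div_cancel_right₀ _ M.spacing_pos.ne', Int.floor_intCast]

theorem latticeCoord_injective : Function.Injective C.latticeCoord := by
  intro v w h
  ext i
  rw [← C.latticeCoord_mul_spacing v, ← C.latticeCoord_mul_spacing w, h]

theorem natAbs_latticeCoord_sub_mul_spacing_le (v w : C.nodes) (i : Fin 2) :
    (C.latticeCoord v i - C.latticeCoord w i).natAbs * M.spacing ≤
      dist (v : EuclideanSpace ℝ (Fin 2)) w := by
  calc ((C.latticeCoord v i - C.latticeCoord w i).natAbs : ℝ) * M.spacing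
      = |C.latticeCoord v i * M.spacing - C.latticeCoord w i * M.spacing| := by
        rw [Nat.cast_natAbs, Int.cast_abs, Int.cast_sub, ← sub_mul, abs_mul,
          abs_of_pos M.spacing_pos]
    _ = ‖((v : EuclideanSpace ℝ (Fin 2)) - w) i‖ := by
        rw [latticeCoord_mul_spacing, latticeCoord_mul_spacing, Real.norm_eq_abs, PiLp.sub_apply]
    _ ≤ dist (v : EuclideanSpace ℝ (Fin 2)) w := by
        rw [dist_eq_norm]
        exact PiLp.norm_apply_le _ i

/-- The cell of a node in the grid of `a × a` blocks of lattice points, shifted along the diagonal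
by `u` steps. -/
noncomputable def gridCell (a u : ℕ) (v : C.nodes) (i : Fin 2) : ℤ := (C.latticeCoord v i + u) / a

theorem card_gridCell_eq_le {ι : Type*} [Fintype ι] {a : ℕ} (ha : 0 < a) (u : ℕ)
    {g : ι → C.nodes} (hg : Function.Injective g) (c : Fin 2 → ℤ) :
    #{j | C.gridCell a u (g j) = c} ≤ a ^ 2 := by
  have ha' : (0 : ℤ) < a := mod_cast ha
  let block : Finset (Fin 2 → ℤ) := Fintype.piFinset fun i => Ico (c i * a - u) (c i * a - u + a)
  calc #{j | C.gridCell a u (g j) = c} ≤ #block := by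
        refine card_le_card_of_injOn (fun j => C.latticeCoord (g j)) (fun j hj => ?_)
          (C.latticeCoord_injective.comp hg).injOn
        have hcell : C.gridCell a u (g j) = c := (mem_filter.1 hj).2
        refine mem_coe.2 (Fintype.mem_piFinset.2 fun i => mem_Ico.2 ?_)
        have hi := (Int.ediv_eq_iff_of_pos ha').1 (congrFun hcell i)
        constructor <;> linarith [hi.1, hi.2]
    _ = a ^ 2 := by simp [block]

theorem card_gridCell_ne_mul_spacing_le {a : ℕ} (ha : 0 < a) (v w : C.nodes) :
    #{u ∈ range a | C.gridCell a u v ≠ C.gridCell a u w} * M.spacing ≤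
      2 * dist (v : EuclideanSpace ℝ (Fin 2)) w := by
  have hcard : #{u ∈ range a | C.gridCell a u v ≠ C.gridCell a u w} ≤
      ∑ i, (C.latticeCoord v i - C.latticeCoord w i).natAbs := by
    calc _ ≤ #(univ.biUnion fun i =>
            {u ∈ range a | C.gridCell a u v i ≠ C.gridCell a u w i}) := by
          refine card_le_card fun u hu => ?_
          obtain ⟨hua, hne⟩ := mem_filter.1 hu
          obtain ⟨i, hi⟩ := Function.ne_iff.1 hne
          exact mem_biUnion.2 ⟨i, mem_univ i, mem_filter.2 ⟨hua, hi⟩⟩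
      _ ≤ ∑ i, #{u ∈ range a | C.gridCell a u v i ≠ C.gridCell a u w i} := card_biUnion_le
      _ ≤ _ := sum_le_sum fun i _ => card_ediv_ne_le ha _ _
  calc #{u ∈ range a | C.gridCell a u v ≠ C.gridCell a u w} * M.spacing
      ≤ (∑ i, (C.latticeCoord v i - C.latticeCoord w i).natAbs : ℕ) * M.spacing := by
        have := M.spacing_pos
        gcongr
    _ = ∑ i, (C.latticeCoord v i - C.latticeCoord w i).natAbs * M.spacing := by
        rw [Nat.cast_sum, sum_mul]
    _ ≤ ∑ _i : Fin 2, dist (v : EuclideanSpace ℝ (Fin 2)) w :=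
        sum_le_sum fun i _ => C.natAbs_latticeCoord_sub_mul_spacing_le v w i
    _ = 2 * dist (v : EuclideanSpace ℝ (Fin 2)) w := by simp

end Circuit

namespace FixedLengthComputation

variable {M : ImplementationModel} {C : Circuit M} {n k : ℕ} (D : FixedLengthComputation C n k)

theorem sum_crossingBits_gridCell_mul_spacing_le {a : ℕ} (ha : 0 < a) :
    (∑ u ∈ range a, D.crossingBits (C.gridCell a u) : ℕ) * M.spacing ≤ 2 * D.bitMeters := by
  have hswap : ∑ u ∈ range a, D.crossingBits (C.gridCell a u) =
      ∑ t, D.size t * #{u ∈ range a | C.gridCell a u (D.src t) ≠ C.gridCell a u (D.dst t)} := by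
    simp only [crossingBits, card_filter, sum_filter, mul_sum, mul_ite, mul_one, mul_zero]
    exact sum_comm
  rw [hswap, bitMeters, Nat.cast_sum, sum_mul, mul_sum]
  refine sum_le_sum fun t _ => ?_
  rw [Nat.cast_mul, mul_assoc, mul_left_comm 2]
  exact mul_le_mul_of_nonneg_left (C.card_gridCell_ne_mul_spacing_le ha _ _) (Nat.cast_nonneg _)

theorem exists_crossingBits_gridCell_le {a : ℕ} (ha : 0 < a) :
    ∃ u, a * (D.crossingBits (C.gridCell a u) * M.spacing) ≤ 2 * D.bitMeters := by
  by_contra! hlt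
  have hsum : ∑ _u ∈ range a, 2 * D.bitMeters <
      ∑ u ∈ range a, a * (D.crossingBits (C.gridCell a u) * M.spacing) :=
    sum_lt_sum_of_nonempty (nonempty_range_iff.2 ha.ne') fun u _ => hlt u
  rw [sum_const, card_range, nsmul_eq_mul, ← mul_sum, ← sum_mul, ← Nat.cast_sum] at hsum
  exact (lt_of_mul_lt_mul_left hsum (Nat.cast_nonneg a)).not_ge
    (D.sum_crossingBits_gridCell_mul_spacing_le ha)

theorem successProb_le_exp_of_bitMeters_le {p : ℝ} (hp₀ : 0 ≤ p) (hp : p ≤ 1 / 2)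
    (enc : (Fin k → Bool) → (Fin n → Bool)) {a : ℕ} (ha : 0 < a)
    (hbits : D.bitMeters ≤ a * k / 4 * M.spacing) :
    successProb p enc D.output ≤ Real.exp (-(k * (2 * p) ^ a ^ 2 / (4 * (a ^ 2 : ℕ)))) := by
  obtain ⟨u, hu⟩ := D.exists_crossingBits_gridCell_le ha
  refine D.successProb_le_exp_of_crossingBits_le (C.gridCell a u) hp₀ hp enc
    (C.card_gridCell_eq_le ha u D.inputNode_injective)
    (C.card_gridCell_eq_le ha u D.outputNode_injective) ?_
  have haspacing : 0 < a * M.spacing := mul_pos (mod_cast ha) M.spacing_pos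
  refine le_of_mul_le_mul_left ?_ haspacing
  linarith

end FixedLengthComputation

section Asymptotics

open Filter

theorem tendsto_rpow_div_log_atTop {ε : ℝ} (hε : 0 < ε) :
    Tendsto (fun x : ℝ => x ^ ε / Real.log x) atTop atTop := by
  have hpos : ∀ᶠ x : ℝ in atTop, 0 < Real.log x / x ^ ε := by
    filter_upwards [eventually_gt_atTop 1] with x hx
    exact div_pos (Real.log_pos hx) (Real.rpow_pos_of_pos (one_pos.trans hx) ε)
  have hzero := (isLittleO_log_rpow_atTop hε).tendsto_div_nhds_zero
  exact (tendsto_inv_nhdsGT_zero.comp (tendsto_nhdsWithin_iff.2 ⟨hzero, hpos⟩)).congr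
    fun x => inv_div _ _

theorem rpow_div_log_le_mul_pow_div {R b c q x k : ℝ} (hR : 0 ≤ R) (hb : 0 ≤ b) (hc : 1 ≤ c)
    (hq : 0 < q) (hx : 1 < x) (hk : R * x ≤ k) (hbq : b ≤ Real.log (1 / q)) {A : ℕ} (hA : 0 < A)
    (hAx : A * (c * Real.log (1 / q)) ≤ Real.log x) :
    R * b / 4 * (x ^ (1 - 1 / c) / Real.log x) ≤ k * q ^ A / (4 * A) := by
  have hx₀ : 0 < x := one_pos.trans hx
  have hlog : 0 < Real.log x := Real.log_pos hx
  have hA₀ : (0 : ℝ) < A := mod_cast hA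
  have hc₀ : 0 < c := one_pos.trans_le hc
  have hpow : x ^ (-(1 / c)) ≤ q ^ A := by
    rw [← Real.rpow_natCast q A, Real.rpow_def_of_pos hx₀, Real.rpow_def_of_pos hq]
    refine Real.exp_le_exp.2 ?_
    rw [one_div, Real.log_inv] at hAx
    have hdiv : -(Real.log q * A) ≤ Real.log x / c := (le_div_iff₀ hc₀).2 (by linarith)
    rw [mul_neg, mul_one_div]
    linarith
  have hcard : b / Real.log x ≤ 1 / A := by
    rw [div_le_div_iff₀ hlog hA₀]
    have hbc : b ≤ c * Real.log (1 / q) :=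
      hbq.trans (le_mul_of_one_le_left (hb.trans hbq) hc)
    linarith [mul_le_mul_of_nonneg_left hbc hA₀.le]
  calc R * b / 4 * (x ^ (1 - 1 / c) / Real.log x)
      = R * x * x ^ (-(1 / c)) * (b / Real.log x) / 4 := by
        rw [sub_eq_add_neg, Real.rpow_add hx₀, Real.rpow_one]
        ring
    _ ≤ k * q ^ A * (1 / A) / 4 := by
        have hk₀ : 0 ≤ k := (by positivity : 0 ≤ R * x).trans hk
        gcongr
    _ = k * q ^ A / (4 * A) := by ring

end Asymptotics

theorem lt_log_of_exp_neg_lt_successProb {n k : ℕ} {R p : ℝ} (hk : R * n ≤ k) (hp₀ : 0 < p)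
    (hp : p ≤ 1 / 2) (enc : (Fin k → Bool) → (Fin n → Bool)) (dec : (Fin n → Bool) → (Fin k → Bool))
    (hsuccess : Real.exp (-(R * Real.log 2 / 2 * n)) < successProb p enc dec) :
    R * Real.log 2 / 2 < Real.log (1 / (2 * p)) := by
  by_contra! hle
  refine hsuccess.not_ge ((successProb_le_exp hp₀ hp enc dec).trans (Real.exp_le_exp.2 ?_))
  have hrate := mul_le_mul_of_nonneg_right hk (Real.log_pos one_lt_two).le
  have hnoise := mul_le_mul_of_nonneg_left hle n.cast_nonneg
  linarith

theorem FixedLengthComputation.le_bitMeters_of_exp_neg_lt_successProb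
    {M : ImplementationModel} {C : Circuit M} {n k : ℕ} (D : FixedLengthComputation C n k)
    {R b c p : ℝ} (hR : 0 ≤ R) (hb : 0 < b) (hc : 1 ≤ c) (hp₀ : 0 < p) (hp : p ≤ 1 / 2)
    (hk : R * n ≤ k) (hbp : b ≤ Real.log (1 / (2 * p)))
    (hcp : c * Real.log (1 / (2 * p)) ≤ Real.log n) (enc : (Fin k → Bool) → (Fin n → Bool))
    (hsuccess : Real.exp (-(R * b / 4 * ((n : ℝ) ^ (1 - 1 / c) / Real.log n))) <
      successProb p enc D.output) :
    k / 8 * √(Real.log n / (c * Real.log (1 / (2 * p)))) * M.spacing ≤ D.bitMeters := by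
  set L := Real.log (1 / (2 * p))
  set s := √(Real.log n / (c * L)) with hs
  have hcL : 0 < c * L := mul_pos (one_pos.trans_le hc) (hb.trans_le hbp)
  have hn : (1 : ℝ) < n := (Real.log_pos_iff n.cast_nonneg).1 (hcL.trans_le hcp)
  have hs₁ : 1 ≤ s := Real.one_le_sqrt.2 ((one_le_div hcL).2 hcp)
  have ha : 0 < ⌊s⌋₊ := Nat.floor_pos.2 hs₁
  have hblock : (⌊s⌋₊ ^ 2 : ℕ) * (c * L) ≤ Real.log n := by
    rw [← le_div_iff₀ hcL, ← Real.sq_sqrt (div_nonneg (hcL.trans_le hcp).le hcL.le), ← hs,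
      Nat.cast_pow]
    gcongr
    exact Nat.floor_le (zero_le_one.trans hs₁)
  by_contra! hlt
  have hbits : D.bitMeters ≤ ⌊s⌋₊ * k / 4 * M.spacing := by
    refine hlt.le.trans (mul_le_mul_of_nonneg_right ?_ M.spacing_pos.le)
    have hfloor := mul_le_mul_of_nonneg_left (Nat.div_two_lt_floor hs₁).le k.cast_nonneg
    linarith
  refine hsuccess.not_ge
    ((D.successProb_le_exp_of_bitMeters_le hp₀.le hp enc ha hbits).trans (Real.exp_le_exp.2 ?_))
  exact neg_le_neg
    (rpow_div_log_le_mul_pow_div hR hb.le hc (by positivity) hn hk hbp (pow_pos ha 2) hblock)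

end InfoFriction

open InfoFriction Filter in
theorem theorem3_general {R δ c : ℝ} (hR : 0 < R) (hδ : 0 < δ) (hc : 1 < c) :
    ∃ N : ℕ, ∀ n k : ℕ, N ≤ n → R * n ≤ k → ∀ p : ℝ, 0 < p → p < 1 / 2 →
      c * Real.log (1 / (2 * p)) ≤ Real.log n →
      ∀ (M : ImplementationModel) (C : Circuit M) (enc : (Fin k → Bool) → (Fin n → Bool))
        (D : FixedLengthComputation C n k), blockErrorProb p enc D.output ≤ 1 - δ →
        k / (8 * √c) * √(Real.log n / Real.log (1 / (2 * p))) * M.spacing ≤ D.bitMeters := by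
  set b := R * Real.log 2 / 2
  have hb : 0 < b := by positivity
  have hsmall {f : ℝ → ℝ} {K : ℝ} (hK : 0 < K) (hf : Tendsto f atTop atTop) :
      ∀ᶠ n : ℕ in atTop, Real.exp (-(K * f n)) < δ :=
    (Real.tendsto_exp_neg_atTop_nhds_zero.comp <|
      (hf.comp tendsto_natCast_atTop_atTop).const_mul_atTop hK).eventually_lt_const hδ
  have hgrowth : Tendsto (fun x : ℝ => x ^ (1 - 1 / c) / Real.log x) atTop atTop :=
    tendsto_rpow_div_log_atTop (sub_pos.2 ((div_lt_one (one_pos.trans hc)).2 hc))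
  obtain ⟨N, hN⟩ := eventually_atTop.1 <|
    (hsmall hb tendsto_id).and (hsmall (by positivity : 0 < R * b / 4) hgrowth)
  refine ⟨N, fun n k hn hk p hp₀ hp hcp M C enc D herror => ?_⟩
  rw [blockErrorProb_eq_one_sub_successProb, sub_le_sub_iff_left] at herror
  have hbp : b < Real.log (1 / (2 * p)) :=
    lt_log_of_exp_neg_lt_successProb hk hp₀ hp.le enc D.output ((hN n hn).1.trans_le herror)
  calc k / (8 * √c) * √(Real.log n / Real.log (1 / (2 * p))) * M.spacing
      = k / 8 * √(Real.log n / (c * Real.log (1 / (2 * p)))) * M.spacing := by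
        rw [mul_comm c, ← div_div (Real.log n), Real.sqrt_div' _ (one_pos.trans hc).le]
        ring
    _ ≤ D.bitMeters :=
        D.le_bitMeters_of_exp_neg_lt_successProb hR.le hb hc.le hp₀ hp.le hk hbp.le hcp enc
          ((hN n hn).2.trans_le herror)

theorem theorem3 (R δ : ℝ) (hR : 0 < R) (hδ : 0 < δ) :
    ∃ N : ℕ, ∀ n k : ℕ, N ≤ n → R * (n : ℝ) ≤ (k : ℝ) →
      ∀ zeta sigmaSq P : ℝ, 0 < zeta → 0 < sigmaSq → 0 < P →
      100 * Real.log (1 / (2 * InfoFriction.crossover zeta sigmaSq P)) < Real.log (n : ℝ) →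
      ∀ (M : InfoFriction.ImplementationModel) (C : InfoFriction.Circuit M)
        (enc : (Fin k → Bool) → (Fin n → Bool))
        (D : InfoFriction.FixedLengthComputation C n k),
        InfoFriction.blockErrorProb (InfoFriction.crossover zeta sigmaSq P) enc D.output ≤ 1 - δ →
        (k : ℝ) / 192 *
            Real.sqrt (Real.log (n : ℝ) /
              Real.log (1 / (2 * InfoFriction.crossover zeta sigmaSq P))) * M.spacing
          ≤ D.bitMeters := by
  obtain ⟨N, hN⟩ := theorem3_general hR hδ (by norm_num : (1 : ℝ) < 100)
  refine ⟨N, fun n k hn hk zeta sigmaSq P hzeta hsigmaSq hP hlog M C enc D herror => le_trans ?_ <|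
    hN n k hn hk _ (InfoFriction.crossover_pos zeta sigmaSq P)
      (InfoFriction.crossover_lt_half hzeta hsigmaSq hP) hlog.le M C enc D herror⟩
  have hspacing := M.spacing_pos
  gcongr
  linarith [Real.sqrt_le_iff.2 (by norm_num : (0 : ℝ) ≤ 24 ∧ (100 : ℝ) ≤ 24 ^ 2)]
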